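/- Let $J$ be a bounded selfadjoint Jacobi operator on $\ell^2=\ell^2(\{0,1,2,\dots\})$, i.e. with respect to the standard basis $e_0,e_1,\dots$ it is represented by the symmetric tridiagonal matrix with real diagonal entries $\alpha_0,\alpha_1,\dots$ and off-diagonal entries $\beta_0,\beta_1,\dots>0$. Suppose there is an $n$ such that $$\alpha_k=0,\qquad \beta_{k-1}=\tfrac12\qquad\text{for all } k\ge n$$ (for the indices that occur), i.e. $J$ equals the free Jacobi operator $\Delta$ ($\alpha_k=0$, $\beta_k=\frac12$ for all $k$) outside the $n\times n$ principal submatrix. Let $P_k$ be the orthonormal polynomials of $J$: $P_0=1$, $sP_0=\alpha_0P_0+\beta_0P_1$, $sP_k=\beta_{k-1}P_{k-1}+\alpha_kP_k+\beta_kP_{k+1}$ for $k\ge1$. Let $P_k^\mu$ be the first associated polynomials: $P_0^\mu=0$, $P_1^\mu=\beta_0^{-1}$, with the same recurrence for $k\ge1$. Let $U_k$ be the orthonormal polynomials of $\Delta$ (the Chebyshev polynomials of the second kind), and define the connection coefficient matrices $C=(c_{ik})_{i,k\ge0}$ and $C^\mu=(c^\mu_{ik})_{i,k\ge0}$ by $P_k=\sum_i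 c_{ik}U_i$ and $P^\mu_k=\sum_i c^\mu_{ik}U_i$. Then there are unique decompositions $C=C_{\rm Toe}+C_{\rm fin}$ and $C^\mu=C^\mu_{\rm Toe}+C^\mu_{\rm fin}$ in which $C_{\rm fin},C^\mu_{\rm fin}$ have only finitely many nonzero entries and $C_{\rm Toe},C^\mu_{\rm Toe}$ are banded upper triangular Toeplitz matrices. Let the polynomials $c$ and $c_\mu$ be the Toeplitz symbols of $C_{\rm Toe}$ and $C^\mu_{\rm Toe}$, where the symbol of a banded upper triangular Toeplitz matrix with entries $t_{k-i}$ for $k\ge i$ is $\sum_k t_kz^k$. Put $\lambda(z)=\frac12(z+z^{-1})$, and let $G(\lambda)=\langle e_0,(J-\lambda)^{-1}e_0\rangle$, $\lambda\in\mathbb C\setminus\sigma(J)$, be the principal resolvent of $J$. Then for every $z$ with $0<|z|<1$ and $\lambda(z)\notin\sigma(J)$ one has $c(z)\ne0$ and $$G(\lambda(z))=-\frac{c_\mu(z)}{c(z)},$$ so that $G(\lambda(z))$ is a rational function of $z$. At $z=0$, where $\lambda(0)=\infty$ and $G(\infty)=0$, one has $c(0)\neq0$ and $c_\mu(0)=0$,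 so that $-c_\mu(0)/c(0)=0$ as well. -/

import Mathlib

open Polynomial

/-- The Hilbert space `ℓ²` of square-summable complex sequences indexed by `0, 1, 2, …`. -/
abbrev EllTwo : Type := lp (fun _ : ℕ => ℂ) 2

/-- The standard orthonormal basis vectors `e_k` of `ℓ²`. -/
noncomputable def stdVec (k : ℕ) : EllTwo := lp.single 2 k (1 : ℂ)

/-- The coefficients `α_k ∈ ℝ`, `β_k > 0` of a Jacobi matrix. -/
structure JacobiCoeffs where
  α : ℕ → ℝ
  β : ℕ → ℝ
  β_pos : ∀ k, 0 < β k

namespace JacobiCoeffs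

/-- The `(i, k)` entry of the symmetric tridiagonal matrix with diagonal `α_0, α_1, …` and
off-diagonals `β_0, β_1, …`. -/
def entry (a : JacobiCoeffs) (i k : ℕ) : ℝ :=
  if i = k then a.α i
  else if k = i + 1 then a.β i
  else if i = k + 1 then a.β k
  else 0

/-- The coefficients of the free Jacobi operator `Δ`: `α_k = 0` and `β_k = 1/2`. -/
noncomputable def free : JacobiCoeffs where
  α := fun _ => 0
  β := fun _ => 1 / 2
  β_pos := fun _ => by norm_num

/-- The orthonormal polynomials: `P_0 = 1`, `s P_0 = α_0 P_0 + β_0 P_1` and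
`s P_k = β_{k-1} P_{k-1} + α_k P_k + β_k P_{k+1}` for `k ≥ 1`. -/
noncomputable def orthoPoly (a : JacobiCoeffs) : ℕ → ℝ[X]
  | 0 => 1
  | 1 => C (a.β 0)⁻¹ * (X - C (a.α 0))
  | k + 2 => C (a.β (k + 1))⁻¹ *
      ((X - C (a.α (k + 1))) * orthoPoly a (k + 1) - C (a.β k) * orthoPoly a k)

/-- The first associated polynomials: the same recurrence for `k ≥ 1`, started from
`P^μ_0 = 0` and `P^μ_1 = β_0⁻¹`. -/
noncomputable def assocPoly (a : JacobiCoeffs) : ℕ → ℝ[X]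
  | 0 => 0
  | 1 => C (a.β 0)⁻¹
  | k + 2 => C (a.β (k + 1))⁻¹ *
      ((X - C (a.α (k + 1))) * assocPoly a (k + 1) - C (a.β k) * assocPoly a k)

theorem degree_orthoPoly (a : JacobiCoeffs) (k : ℕ) : (a.orthoPoly k).degree = k := by
  induction k using Nat.strong_induction_on with
  | _ k ih =>
    match k, ih with
    | 0, _ => simp [orthoPoly]
    | 1, _ =>
      have h := (a.β_pos 0).ne'
      simp [orthoPoly, degree_mul, degree_C (inv_ne_zero h)]
    | k + 2, ih =>
      have h := (a.β_pos (k + 1)).ne'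
      have h1 := ih (k + 1) (by omega)
      have h0 := ih k (by omega)
      have hlt : (C (a.β k) * a.orthoPoly k).degree <
          ((X - C (a.α (k + 1))) * a.orthoPoly (k + 1)).degree := by
        rw [degree_mul, degree_mul, h0, h1, degree_X_sub_C, degree_C (a.β_pos k).ne']
        norm_cast
        omega
      rw [orthoPoly, degree_mul, degree_C (inv_ne_zero h), degree_sub_eq_left_of_degree_lt hlt,
        degree_mul, h1, degree_X_sub_C]
      norm_cast
      omega

/-- The orthonormal polynomials form a basis of the space of real polynomials. -/
noncomputable def polyBasis (a : JacobiCoeffs) : Module.Basis ℕ ℝ ℝ[X] :=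
  Polynomial.Sequence.basis ⟨a.orthoPoly, a.degree_orthoPoly⟩
    (fun i => isUnit_iff_ne_zero.2 (leadingCoeff_ne_zero.2 (Polynomial.Sequence.ne_zero _ i)))

end JacobiCoeffs

/-- The connection coefficient matrix from a sequence of polynomials `p_0, p_1, …` to the
orthonormal polynomials `Q_0, Q_1, …` of the Jacobi coefficients `d`: the `(i, k)` entry is the
coefficient of `Q_i` in the (finite, unique) expansion `p_k = ∑ i, c_{i,k} Q_i`. -/
noncomputable def connectionMatrix (p : ℕ → ℝ[X]) (d : JacobiCoeffs) (i k : ℕ) : ℝ :=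
  d.polyBasis.repr (p k) i

/-- The matrix `C = C_{J → Δ}` connecting the orthonormal polynomials of `J` to those of `Δ`. -/
noncomputable def connC (a : JacobiCoeffs) : ℕ → ℕ → ℝ :=
  connectionMatrix a.orthoPoly JacobiCoeffs.free

/-- The matrix `C^μ` connecting the first associated polynomials of `J` to the orthonormal
polynomials of `Δ`. -/
noncomputable def connCmu (a : JacobiCoeffs) : ℕ → ℕ → ℝ :=
  connectionMatrix a.assocPoly JacobiCoeffs.free

/-- The banded upper triangular Toeplitz matrix with symbol `t_0 + t_1 z + ⋯ + t_m z^m`: its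
`(i, k)` entry is `t_{k-i}` if `i ≤ k` and `0` otherwise. -/
noncomputable def toeplitzMatrix (t : ℝ[X]) (i k : ℕ) : ℝ :=
  if i ≤ k then t.coeff (k - i) else 0

/-- `t` is the Toeplitz symbol of the Toeplitz part of `M`, i.e. `M = M_Toe + M_fin`, where `M_Toe`
is the Toeplitz matrix with symbol `t` and `M_fin` has only finitely many nonzero entries. -/
def IsToeplitzSymbol (M : ℕ → ℕ → ℝ) (t : ℝ[X]) : Prop :=
  {q : ℕ × ℕ | M q.1 q.2 - toeplitzMatrix t q.1 q.2 ≠ 0}.Finite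

/-- `J` is the (bounded, selfadjoint) Jacobi operator on `ℓ²` with coefficients `a`. -/
structure IsJacobiOperator (a : JacobiCoeffs) (J : EllTwo →L[ℂ] EllTwo) : Prop where
  isSelfAdjoint : IsSelfAdjoint J
  inner_eq : ∀ i k, inner ℂ (stdVec i) (J (stdVec k)) = (a.entry i k : ℂ)

/-- The principal resolvent `G(w) = ⟨e_0, (J - w)⁻¹ e_0⟩`, meaningful for `w` outside the spectrum
of `J`. -/
noncomputable def principalResolvent (J : EllTwo →L[ℂ] EllTwo) (w : ℂ) : ℂ :=
  inner ℂ (stdVec 0) (Ring.inverse (J - algebraMap ℂ (EllTwo →L[ℂ] EllTwo) w) (stdVec 0))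

/-- The Joukowski map `z ↦ (z + z⁻¹) / 2`. -/
noncomputable def joukowski (z : ℂ) : ℂ := (z + z⁻¹) / 2

/-! Expanding `X * p k` in the Chebyshev basis both by the recurrence of `a` and by that of `free`
gives a discrete wave equation for the connection coefficients. Once the coefficients of `a` are
free, that equation carries diagonal increments unchanged along antidiagonals. Upper triangularity
then makes them zero, so the matrix is Toeplitz far out (`exists_isToeplitzSymbol_of_recurrence`).

Summing a far column gives `(z⁻¹ - z) P_k(λ(z)) = z⁻ᵏ⁻¹ c(z) - zᵏ⁺¹ c(z⁻¹)`, and likewise for the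
associated polynomials (`eventually_aeval_eq`). The vector `(J - λ)⁻¹ e_0` has entries `G P_k +
P^μ_k`, which tend to zero, so the growing coefficient `G c + c_μ` vanishes. If `c(z) = 0`, then
`c_μ(z) = 0` too and both solutions decay, contradicting their constant nonzero Wronskian. -/

open Filter Topology

/-! ### Three-term recurrences and multiplication by `X` in the Chebyshev basis -/

namespace JacobiCoeffs

/-- Solutions of the three-term recurrence of `a`, in a module on which `x` acts as the spectral
parameter. -/
def IsRecurrent (a : JacobiCoeffs) {R : Type*} [CommRing R] [Algebra ℝ R] (x : R) (p : ℕ → R) :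
    Prop :=
  ∀ k, x * p (k + 1) =
    algebraMap ℝ R (a.β k) * p k + algebraMap ℝ R (a.α (k + 1)) * p (k + 1) +
      algebraMap ℝ R (a.β (k + 1)) * p (k + 2)

theorem isRecurrent_of_eq (a : JacobiCoeffs) {p : ℕ → ℝ[X]}
    (h : ∀ k, p (k + 2) = C (a.β (k + 1))⁻¹ *
      ((X - C (a.α (k + 1))) * p (k + 1) - C (a.β k) * p k)) :
    a.IsRecurrent X p := by
  intro k
  have hb : (C (a.β (k + 1)) * C (a.β (k + 1))⁻¹ : ℝ[X]) = 1 := by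
    rw [← C_mul, mul_inv_cancel₀ (a.β_pos _).ne', C_1]
  rw [h k]
  simp only [Polynomial.algebraMap_eq]
  linear_combination (-((X - C (a.α (k + 1))) * p (k + 1) - C (a.β k) * p k)) * hb

theorem isRecurrent_orthoPoly (a : JacobiCoeffs) : a.IsRecurrent X a.orthoPoly :=
  a.isRecurrent_of_eq fun _ => by rw [orthoPoly]

theorem isRecurrent_assocPoly (a : JacobiCoeffs) : a.IsRecurrent X a.assocPoly :=
  a.isRecurrent_of_eq fun _ => by rw [assocPoly]

theorem IsRecurrent.aeval {a : JacobiCoeffs} {p : ℕ → ℝ[X]} (h : a.IsRecurrent X p) (w : ℂ) :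
    a.IsRecurrent w fun k => Polynomial.aeval w (p k) := by
  intro k
  have := congrArg (Polynomial.aeval w) (h k)
  simpa using this

theorem IsRecurrent.eq_of_eq {a : JacobiCoeffs} {w : ℂ} {u v : ℕ → ℂ}
    (hu : a.IsRecurrent w u) (hv : a.IsRecurrent w v) (h0 : u 0 = v 0) (h1 : u 1 = v 1) :
    u = v := by
  have key : ∀ k, u k = v k ∧ u (k + 1) = v (k + 1) := by
    intro k
    induction k with
    | zero => exact ⟨h0, h1⟩
    | succ k ih =>
      refine ⟨ih.2, ?_⟩
      have hb : (algebraMap ℝ ℂ (a.β (k + 1))) ≠ 0 := by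
        simpa using (a.β_pos (k + 1)).ne'
      have e1 := hu k
      have e2 := hv k
      rw [ih.1, ih.2] at e1
      exact mul_left_cancel₀ hb (by linear_combination e2 - e1)
  exact funext fun k => (key k).1

/-- The Wronskian of two solutions is constant. -/
theorem IsRecurrent.wronskian {a : JacobiCoeffs} {w : ℂ} {u v : ℕ → ℂ}
    (hu : a.IsRecurrent w u) (hv : a.IsRecurrent w v) (k : ℕ) :
    (a.β k : ℂ) * (u k * v (k + 1) - u (k + 1) * v k) =
      (a.β 0 : ℂ) * (u 0 * v 1 - u 1 * v 0) := by
  induction k with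
  | zero => rfl
  | succ k ih =>
    rw [← ih]
    have e1 := hu k
    have e2 := hv k
    simp only [Complex.coe_algebraMap] at e1 e2
    linear_combination v (k + 1) * e1 - u (k + 1) * e2

theorem polyBasis_apply (a : JacobiCoeffs) (k : ℕ) : a.polyBasis k = a.orthoPoly k := by
  simp only [polyBasis, Polynomial.Sequence.basis_eq_self]

theorem repr_orthoPoly (a : JacobiCoeffs) (k : ℕ) :
    a.polyBasis.repr (a.orthoPoly k) = Finsupp.single k 1 := by
  rw [← polyBasis_apply, Module.Basis.repr_self]

theorem X_mul_orthoPoly_free_zero :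
    X * free.orthoPoly 0 = (1 / 2 : ℝ) • free.orthoPoly 1 := by
  simp only [orthoPoly, free, smul_eq_C_mul]
  rw [← mul_assoc, ← C_mul]
  norm_num

theorem X_mul_orthoPoly_free_succ (k : ℕ) :
    X * free.orthoPoly (k + 1) =
      (1 / 2 : ℝ) • free.orthoPoly k + (1 / 2 : ℝ) • free.orthoPoly (k + 2) := by
  have := free.isRecurrent_orthoPoly k
  simpa [free, smul_eq_C_mul] using this

theorem repr_X_mul_zero (p : ℝ[X]) :
    free.polyBasis.repr (X * p) 0 = 1 / 2 * free.polyBasis.repr p 1 := by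
  have : (Finsupp.lapply 0 ∘ₗ free.polyBasis.repr.toLinearMap) ∘ₗ LinearMap.mulLeft ℝ (X : ℝ[X]) =
      (1 / 2 : ℝ) • (Finsupp.lapply 1 ∘ₗ free.polyBasis.repr.toLinearMap) := by
    refine free.polyBasis.ext fun k => ?_
    rw [polyBasis_apply]
    simp only [LinearMap.comp_apply, LinearMap.mulLeft_apply, LinearMap.smul_apply,
      LinearEquiv.coe_coe, Finsupp.lapply_apply]
    cases k with
    | zero =>
      rw [X_mul_orthoPoly_free_zero, map_smul, repr_orthoPoly, repr_orthoPoly]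
      simp
    | succ k =>
      rw [X_mul_orthoPoly_free_succ, map_add free.polyBasis.repr, map_smul, map_smul]
      simp only [repr_orthoPoly, Finsupp.add_apply, Finsupp.smul_apply, Finsupp.single_apply]
      simp
  simpa using LinearMap.congr_fun this p

theorem repr_X_mul_succ (p : ℝ[X]) (i : ℕ) :
    free.polyBasis.repr (X * p) (i + 1) =
      1 / 2 * (free.polyBasis.repr p i + free.polyBasis.repr p (i + 2)) := by
  have : (Finsupp.lapply (i + 1) ∘ₗ free.polyBasis.repr.toLinearMap) ∘ₗ
        LinearMap.mulLeft ℝ (X : ℝ[X]) =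
      (1 / 2 : ℝ) • (Finsupp.lapply i ∘ₗ free.polyBasis.repr.toLinearMap +
        Finsupp.lapply (i + 2) ∘ₗ free.polyBasis.repr.toLinearMap) := by
    refine free.polyBasis.ext fun k => ?_
    rw [polyBasis_apply]
    simp only [LinearMap.comp_apply, LinearMap.mulLeft_apply, LinearMap.smul_apply,
      LinearMap.add_apply, LinearEquiv.coe_coe, Finsupp.lapply_apply]
    cases k with
    | zero =>
      rw [X_mul_orthoPoly_free_zero, map_smul, repr_orthoPoly, repr_orthoPoly]
      simp only [Finsupp.smul_apply, Finsupp.single_apply]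
      simp [eq_comm]
    | succ k =>
      rw [X_mul_orthoPoly_free_succ, map_add free.polyBasis.repr, map_smul, map_smul]
      simp only [repr_orthoPoly, Finsupp.add_apply, Finsupp.smul_apply, Finsupp.single_apply]
      simp only [smul_eq_mul, show (k + 2 = i + 1) = (k + 1 = i) by simp,
        show (k + 1 = i + 2) = (k = i + 1) by simp]
      ring
  exact LinearMap.congr_fun this p

end JacobiCoeffs

open JacobiCoeffs

/-! ### The wave equation and triangularity of connection coefficients -/

section Connection

variable {a : JacobiCoeffs} {p : ℕ → ℝ[X]}

theorem connectionMatrix_zero_succ (h : a.IsRecurrent X p) (k : ℕ) :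
    1 / 2 * connectionMatrix p free 1 (k + 1) =
      a.β k * connectionMatrix p free 0 k + a.α (k + 1) * connectionMatrix p free 0 (k + 1) +
        a.β (k + 1) * connectionMatrix p free 0 (k + 2) := by
  have := repr_X_mul_zero (p (k + 1))
  rw [h k] at this
  simp only [Polynomial.algebraMap_eq, ← smul_eq_C_mul, map_add, map_smul, Finsupp.add_apply,
    Finsupp.smul_apply, smul_eq_mul] at this
  exact this.symm

theorem connectionMatrix_succ_succ (h : a.IsRecurrent X p) (i k : ℕ) :
    1 / 2 * (connectionMatrix p free i (k + 1) + connectionMatrix p free (i + 2) (k + 1)) =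
      a.β k * connectionMatrix p free (i + 1) k +
        a.α (k + 1) * connectionMatrix p free (i + 1) (k + 1) +
        a.β (k + 1) * connectionMatrix p free (i + 1) (k + 2) := by
  have := repr_X_mul_succ (p (k + 1)) i
  rw [h k] at this
  simp only [Polynomial.algebraMap_eq, ← smul_eq_C_mul, map_add, map_smul, Finsupp.add_apply,
    Finsupp.smul_apply, smul_eq_mul] at this
  exact this.symm

/-- The offset `s` treats both families at once: `s = 1` for degree `k`, `s = 0` for the associated
polynomials, of degree below `k`. -/
theorem connectionMatrix_eq_zero_of_le (h : a.IsRecurrent X p) {s : ℕ}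
    (h0 : ∀ i, s ≤ i → connectionMatrix p free i 0 = 0)
    (h1 : ∀ i, s + 1 ≤ i → connectionMatrix p free i 1 = 0) (i k : ℕ) (hik : k + s ≤ i) :
    connectionMatrix p free i k = 0 := by
  induction k using Nat.strong_induction_on generalizing i with
  | _ k ih =>
    match k, ih with
    | 0, _ => exact h0 i (by omega)
    | 1, _ => exact h1 i (by omega)
    | k + 2, ih =>
      obtain ⟨i, rfl⟩ : ∃ j, i = j + 1 := ⟨i - 1, by omega⟩
      have e := connectionMatrix_succ_succ h i k
      rw [ih (k + 1) (by omega) i (by omega), ih (k + 1) (by omega) (i + 2) (by omega),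
        ih k (by omega) (i + 1) (by omega), ih (k + 1) (by omega) (i + 1) (by omega)] at e
      have hb := (a.β_pos (k + 1)).ne'
      simpa [hb] using e.symm

theorem connectionMatrix_of_eq_C {k : ℕ} {r : ℝ} (hp : p k = C r) (i : ℕ) :
    connectionMatrix p free i k = if i = 0 then r else 0 := by
  have : p k = r • free.orthoPoly 0 := by rw [hp, orthoPoly, smul_eq_C_mul, mul_one]
  rw [connectionMatrix, this, map_smul, repr_orthoPoly, Finsupp.smul_apply, Finsupp.single_apply]
  simp [eq_comm]

theorem connCmu_eq_zero_of_le (a : JacobiCoeffs) (i k : ℕ) (hik : k ≤ i) :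
    connCmu a i k = 0 := by
  refine connectionMatrix_eq_zero_of_le (s := 0) a.isRecurrent_assocPoly (fun i _ => ?_)
    (fun i hi => ?_) i k (by omega)
  · rw [connectionMatrix_of_eq_C (r := 0) (by simp [assocPoly])]
    simp
  · rw [connectionMatrix_of_eq_C (r := (a.β 0)⁻¹) (by simp [assocPoly]), if_neg (by omega)]

theorem connC_zero_zero (a : JacobiCoeffs) : connC a 0 0 = 1 := by
  rw [connC, connectionMatrix_of_eq_C (r := 1) (by simp [orthoPoly])]
  simp

theorem connC_succ_one (a : JacobiCoeffs) (i : ℕ) :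
    connC a (i + 1) 1 = if i = 0 then (a.β 0)⁻¹ * (1 / 2) else 0 := by
  have : a.orthoPoly 1 = (a.β 0)⁻¹ • (X * C 1) - ((a.β 0)⁻¹ * a.α 0) • 1 := by
    simp [orthoPoly, smul_eq_C_mul]
    ring
  have e : free.polyBasis.repr (1 : ℝ[X]) = Finsupp.single 0 1 := by
    have := free.repr_orthoPoly 0
    rwa [orthoPoly] at this
  rw [connC, connectionMatrix, this, map_sub, map_smul, map_smul, Finsupp.sub_apply,
    Finsupp.smul_apply, Finsupp.smul_apply, repr_X_mul_succ, C_1, e]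
  simp only [Finsupp.single_apply]
  simp [eq_comm]

theorem connC_eq_zero_of_lt (a : JacobiCoeffs) (i k : ℕ) (hik : k < i) :
    connC a i k = 0 := by
  refine connectionMatrix_eq_zero_of_le (s := 1) a.isRecurrent_orthoPoly (fun i _ => ?_)
    (fun i hi => ?_) i k (by omega)
  · rw [connectionMatrix_of_eq_C (r := 1) (by simp [orthoPoly]), if_neg (by omega)]
  · obtain ⟨i, rfl⟩ : ∃ j, i = j + 1 := ⟨i - 1, by omega⟩
    exact (connC_succ_one a i).trans (if_neg (by omega))

/-- Below the diagonal everything vanishes, so the wave equation links consecutive diagonal entries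
by a nonzero factor. This yields `c(0) ≠ 0`. -/
theorem connC_diag_ne_zero (a : JacobiCoeffs) (k : ℕ) : connC a k k ≠ 0 := by
  induction k with
  | zero => simp [connC_zero_zero]
  | succ k ih =>
    cases k with
    | zero => simp [connC_succ_one, (a.β_pos 0).ne']
    | succ k =>
      have e := connectionMatrix_succ_succ a.isRecurrent_orthoPoly (k + 1) k
      change 1 / 2 * (connC a (k + 1) (k + 1) + connC a (k + 1 + 2) (k + 1)) =
        a.β k * connC a (k + 1 + 1) k + a.α (k + 1) * connC a (k + 1 + 1) (k + 1) +
        a.β (k + 1) * connC a (k + 1 + 1) (k + 2) at e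
      rw [connC_eq_zero_of_lt a (k + 1 + 2) (k + 1) (by omega),
        connC_eq_zero_of_lt a (k + 1 + 1) k (by omega),
        connC_eq_zero_of_lt a (k + 1 + 1) (k + 1) (by omega)] at e
      intro h0
      rw [h0] at e
      apply ih
      linarith

end Connection

/-! ### Toeplitz symbols: uniqueness and existence -/

section Toeplitz

variable {M : ℕ → ℕ → ℝ} {t : ℝ[X]}

theorem isToeplitzSymbol_iff :
    IsToeplitzSymbol M t ↔ ∃ K, ∀ i k, K ≤ i + k → M i k = toeplitzMatrix t i k := by
  constructor
  · intro h
    obtain ⟨K, hK⟩ := (h.image fun q : ℕ × ℕ => q.1 + q.2).bddAbove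
    refine ⟨K + 1, fun i k hik => ?_⟩
    by_contra hne
    have : i + k ≤ K := hK ⟨(i, k), sub_ne_zero.2 hne, rfl⟩
    omega
  · rintro ⟨K, hK⟩
    refine ((Set.finite_Iio K).prod (Set.finite_Iio K)).subset ?_
    rintro ⟨i, k⟩ hq
    by_contra hn
    apply hq
    simp only [Set.mem_prod, Set.mem_Iio, not_and_or, not_lt] at hn
    rw [hK i k (by omega), sub_self]

theorem IsToeplitzSymbol.exists_coeff_eq (h : IsToeplitzSymbol M t) :
    ∃ K, ∀ i j, K ≤ i → t.coeff j = M i (i + j) := by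
  obtain ⟨K, hK⟩ := isToeplitzSymbol_iff.1 h
  refine ⟨K, fun i j hi => ?_⟩
  rw [hK i (i + j) (by omega)]
  simp [toeplitzMatrix]

theorem IsToeplitzSymbol.unique {t' : ℝ[X]} (h : IsToeplitzSymbol M t)
    (h' : IsToeplitzSymbol M t') : t = t' := by
  obtain ⟨K, hK⟩ := h.exists_coeff_eq
  obtain ⟨K', hK'⟩ := h'.exists_coeff_eq
  ext j
  rw [hK (max K K') j (le_max_left _ _), hK' (max K K') j (le_max_right _ _)]

theorem exists_isToeplitzSymbol_of_recurrence (N : ℕ) (hM : ∀ i k, k < i → M i k = 0)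
    (h0 : ∀ k, N ≤ k → M 1 (k + 1) = M 0 k + M 0 (k + 2))
    (h1 : ∀ i k, N ≤ k → M i (k + 1) + M (i + 2) (k + 1) = M (i + 1) k + M (i + 1) (k + 2)) :
    ∃ t, IsToeplitzSymbol M t := by
  -- The increment `M (i+1) (k+1) - M i k` is constant along antidiagonals; slide it down to column
  -- `N`.
  have anti : ∀ m i, M (i + 1) (N + m + 1) - M i (N + m) =
      M (i + m + 1) (N + 1) - M (i + m) N := by
    intro m
    induction m with
    | zero => intro i; rfl
    | succ m ih =>
      intro i
      have e := h1 i (N + m) (by omega)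
      have e2 := ih (i + 1)
      rw [show i + (m + 1) = i + 1 + m by omega, ← e2]
      rw [show N + (m + 1) + 1 = N + m + 2 by omega, show N + (m + 1) = N + m + 1 by omega]
      linarith
  -- When `i + k > 2 * N`, the slide ends strictly below the diagonal, where both entries are zero.
  have shift : ∀ i k, 2 * N < i + k → M (i + 1) (k + 1) = M i k := by
    intro i k hik
    rcases lt_or_ge k i with hki | hki
    · rw [hM _ _ hki, hM _ _ (by omega)]
    · obtain ⟨m, rfl⟩ : ∃ m, k = N + m := ⟨k - N, by omega⟩
      have := anti m i
      rw [hM (i + m + 1) (N + 1) (by omega), hM (i + m) N (by omega)] at this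
      linarith
  -- The boundary equation for row `0` combined with `shift 0 k` leaves `M 0 (k + 2) = 0`, which
  -- bounds the band.
  have top : ∀ j, 2 * N + 3 ≤ j → M 0 j = 0 := by
    intro j hj
    obtain ⟨k, rfl⟩ : ∃ k, j = k + 2 := ⟨j - 2, by omega⟩
    have e := h0 k (by omega)
    have := shift 0 k (by omega)
    rw [zero_add] at this
    linarith
  have diag : ∀ s i j, 2 * N < i + (i + j) → M (i + s) (i + s + j) = M i (i + j) := by
    intro s i j hij
    induction s with
    | zero => rfl
    | succ s ih =>
      rw [← ih, show i + (s + 1) + j = i + s + j + 1 by omega, ← add_assoc]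
      exact shift _ _ (by omega)
  have far : ∀ i j, 2 * N + 3 ≤ j → M i (i + j) = 0 := by
    intro i j hj
    have := diag i 0 j (by omega)
    rw [zero_add, zero_add] at this
    rw [this, top j hj]
  -- Diagonals are constant from row `2 * N + 1` on. Inside the band, `i + k ≥ 6 * N + 5` forces `i`
  -- past that row.
  refine ⟨∑ j ∈ Finset.range (2 * N + 3),
    monomial j (M (2 * N + 1) (2 * N + 1 + j)), isToeplitzSymbol_iff.2
    ⟨6 * N + 5, fun i k hik => ?_⟩⟩
  rw [toeplitzMatrix]
  split_ifs with hle
  · obtain ⟨j, rfl⟩ : ∃ j, k = i + j := ⟨k - i, by omega⟩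
    simp only [finsetSum_coeff, coeff_monomial, Nat.add_sub_cancel_left, Finset.sum_ite_eq',
      Finset.mem_range]
    split_ifs with hj
    · obtain ⟨s, rfl⟩ : ∃ s, i = 2 * N + 1 + s := ⟨i - (2 * N + 1), by omega⟩
      exact diag s _ j (by omega)
    · exact far i j (by omega)
  · exact hM i k (by omega)

end Toeplitz

theorem exists_isToeplitzSymbol_connectionMatrix {a : JacobiCoeffs} {p : ℕ → ℝ[X]} {n : ℕ}
    (hα : ∀ k, n ≤ k → a.α k = 0) (hβ : ∀ k, n ≤ k + 1 → a.β k = 1 / 2)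
    (h : a.IsRecurrent X p) (htri : ∀ i k, k < i → connectionMatrix p free i k = 0) :
    ∃ t, IsToeplitzSymbol (connectionMatrix p free) t := by
  refine exists_isToeplitzSymbol_of_recurrence n htri (fun k hk => ?_) (fun i k hk => ?_)
  · have e := connectionMatrix_zero_succ h k
    rw [hα _ (by omega), hβ k (by omega), hβ (k + 1) (by omega)] at e
    linarith
  · have e := connectionMatrix_succ_succ h i k
    rw [hα _ (by omega), hβ k (by omega), hβ (k + 1) (by omega)] at e
    linarith

/-! ### Growing and decaying solutions in the Joukowski variable -/

section Asymptotics

variable {z : ℂ}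

theorem aeval_joukowski_orthoPoly_free (hz : z ≠ 0) (m : ℕ) :
    (z⁻¹ - z) * aeval (joukowski z) (free.orthoPoly m) = z⁻¹ ^ (m + 1) - z ^ (m + 1) := by
  induction m using Nat.strong_induction_on with
  | _ m ih =>
    match m, ih with
    | 0, _ => simp [orthoPoly]
    | 1, _ =>
      simp only [orthoPoly, free, joukowski]
      simp
      ring
    | m + 2, ih =>
      have e := free.isRecurrent_orthoPoly.aeval (joukowski z) m
      have e0 := ih m (by omega)
      have e1 := ih (m + 1) (by omega)
      simp only [free, joukowski, Complex.coe_algebraMap, Complex.ofReal_zero, zero_mul, add_zero]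
        at e e0 e1 ⊢
      push_cast at e
      have hzz : z * z⁻¹ = 1 := mul_inv_cancel₀ hz
      linear_combination (-2 * (z⁻¹ - z)) * e + (z + z⁻¹) * e1 - e0 +
        (z⁻¹ ^ (m + 1) - z ^ (m + 1)) * hzz

theorem eventually_aeval_eq {p : ℕ → ℝ[X]} {t : ℝ[X]}
    (htri : ∀ i k, k < i → connectionMatrix p free i k = 0)
    (ht : IsToeplitzSymbol (connectionMatrix p free) t) (hz : z ≠ 0) :
    ∀ᶠ k in atTop, (z⁻¹ - z) * aeval (joukowski z) (p k) =
      z⁻¹ ^ (k + 1) * aeval z t - z ^ (k + 1) * aeval z⁻¹ t := by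
  obtain ⟨K, hK⟩ := isToeplitzSymbol_iff.1 ht
  -- The first bound makes all of column `k` Toeplitz; the second ensures that the column contains
  -- every coefficient of `t`.
  filter_upwards [eventually_ge_atTop K, eventually_ge_atTop t.natDegree] with k hk hdeg
  have hp : p k = ∑ i ∈ Finset.range (k + 1), t.coeff (k - i) • free.orthoPoly i := by
    conv_lhs => rw [← free.polyBasis.linearCombination_repr (p k)]
    rw [Finsupp.linearCombination_apply, Finsupp.sum_of_support_subset
      (s := Finset.range (k + 1))]
    · refine Finset.sum_congr rfl fun i hi => ?_
      have hi' : i ≤ k := by simpa [Nat.lt_succ_iff] using hi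
      have := hK i k (by omega)
      rw [toeplitzMatrix, if_pos hi', connectionMatrix] at this
      rw [this, polyBasis_apply]
    · intro i hi
      by_contra hn
      exact Finsupp.mem_support_iff.1 hi (htri i k (by simpa [Nat.lt_succ_iff] using hn))
    · simp
  rw [hp, map_sum, Finset.mul_sum, ← Finset.sum_range_reflect,
    aeval_eq_sum_range' (Nat.lt_succ_of_le hdeg), aeval_eq_sum_range' (Nat.lt_succ_of_le hdeg),
    Finset.mul_sum, Finset.mul_sum, ← Finset.sum_sub_distrib]
  refine Finset.sum_congr rfl fun j hj => ?_
  have hj' : j ≤ k := by simpa [Nat.lt_succ_iff] using hj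
  obtain ⟨m, rfl⟩ : ∃ m, k = j + m := ⟨k - j, by omega⟩
  have e := aeval_joukowski_orthoPoly_free hz m
  rw [show j + m + 1 - 1 - j = m by omega, show j + m - m = j by omega, map_smul,
    Complex.real_smul, Complex.real_smul, Complex.real_smul]
  have hzz : z⁻¹ ^ j * z ^ j = 1 := by rw [← mul_pow, inv_mul_cancel₀ hz, one_pow]
  have p1 : z⁻¹ ^ (j + m + 1) = z⁻¹ ^ j * z⁻¹ ^ (m + 1) := by ring
  have p2 : z ^ (j + m + 1) = z ^ j * z ^ (m + 1) := by ring
  rw [p1, p2]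
  linear_combination (t.coeff j : ℂ) * e -
    (t.coeff j : ℂ) * (z⁻¹ ^ (m + 1) - z ^ (m + 1)) * hzz

theorem inv_sub_self_ne_zero (hz : z ≠ 0) (hz1 : ‖z‖ < 1) : z⁻¹ - z ≠ 0 := by
  intro h
  have : z * z = 1 := by
    rw [sub_eq_zero] at h
    nth_rewrite 1 [← h]
    exact inv_mul_cancel₀ hz
  have := congrArg norm this
  rw [norm_mul, norm_one] at this
  nlinarith [norm_nonneg z]

theorem tendsto_pow_succ_mul (hz1 : ‖z‖ < 1) (b : ℂ) :
    Tendsto (fun k : ℕ => z ^ (k + 1) * b) atTop (𝓝 0) := by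
  have := ((tendsto_pow_atTop_nhds_zero_of_norm_lt_one hz1).comp
    (tendsto_add_atTop_nat 1)).mul_const b
  simpa using this

/-- A sequence tending to zero has no component along the growing solution `z⁻ᵏ`. -/
theorem eq_zero_of_tendsto_zero (hz : z ≠ 0) (hz1 : ‖z‖ < 1) {u : ℕ → ℂ} {A B : ℂ}
    (hu : Tendsto u atTop (𝓝 0))
    (h : ∀ᶠ k in atTop, u k = z⁻¹ ^ (k + 1) * A - z ^ (k + 1) * B) : A = 0 := by
  -- Multiplying by `z ^ (k + 1)` turns the growing term into the constant `A` and sends everything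
  -- else to zero.
  have h1 : Tendsto (fun k : ℕ => z ^ (k + 1) * 1 * (u k + z ^ (k + 1) * B)) atTop (𝓝 0) := by
    simpa using (tendsto_pow_succ_mul hz1 1).mul (hu.add (tendsto_pow_succ_mul hz1 B))
  refine tendsto_nhds_unique (tendsto_const_nhds.congr' ?_) h1
  filter_upwards [h] with k hk
  have hzz : z ^ (k + 1) * z⁻¹ ^ (k + 1) = 1 := by rw [← mul_pow, mul_inv_cancel₀ hz, one_pow]
  rw [hk]
  linear_combination -A * hzz

theorem tendsto_zero_of_eventually_eq (hz : z ≠ 0) (hz1 : ‖z‖ < 1) {u : ℕ → ℂ} {B : ℂ}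
    (h : ∀ᶠ k in atTop, (z⁻¹ - z) * u k = z⁻¹ ^ (k + 1) * 0 - z ^ (k + 1) * B) :
    Tendsto u atTop (𝓝 0) := by
  have hne := inv_sub_self_ne_zero hz hz1
  refine (tendsto_pow_succ_mul hz1 (-((z⁻¹ - z)⁻¹ * B))).congr' ?_
  filter_upwards [h] with k hk
  refine mul_left_cancel₀ hne ?_
  rw [hk]
  linear_combination (-(z ^ (k + 1) * B)) * mul_inv_cancel₀ hne

end Asymptotics

/-! ### The resolvent vector as a decaying solution -/

section Resolvent

theorem inner_stdVec (k : ℕ) (v : EllTwo) : inner ℂ (stdVec k) v = v k := by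
  rw [stdVec, lp.inner_single_left]
  simp

theorem stdVec_apply (k i : ℕ) : stdVec k i = if i = k then 1 else 0 := by
  rw [stdVec, lp.single_apply, Pi.single_apply]

theorem EllTwo.tendsto_zero (v : EllTwo) : Tendsto (fun k => v k) atTop (𝓝 0) := by
  have := (lp.memℓp v).summable (by norm_num)
  have h := this.tendsto_atTop_zero
  rw [tendsto_zero_iff_norm_tendsto_zero]
  have h2 : Tendsto (fun k => ‖v k‖ ^ 2) atTop (𝓝 0) := by
    simpa using h
  have h3 := h2.sqrt
  simpa [Real.sqrt_sq] using h3

variable {a : JacobiCoeffs} {J : EllTwo →L[ℂ] EllTwo}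

theorem IsJacobiOperator.apply_stdVec_zero (hJ : IsJacobiOperator a J) :
    J (stdVec 0) = (a.α 0 : ℂ) • stdVec 0 + (a.β 0 : ℂ) • stdVec 1 := by
  ext i
  rw [← inner_stdVec i (J _), hJ.inner_eq, entry]
  simp only [lp.coeFn_add, lp.coeFn_smul, Pi.add_apply, Pi.smul_apply, stdVec_apply, smul_eq_mul]
  rcases i with _ | _ | i <;> simp

theorem IsJacobiOperator.apply_stdVec_succ (hJ : IsJacobiOperator a J) (k : ℕ) :
    J (stdVec (k + 1)) = (a.β k : ℂ) • stdVec k + (a.α (k + 1) : ℂ) • stdVec (k + 1) +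
      (a.β (k + 1) : ℂ) • stdVec (k + 2) := by
  ext i
  rw [← inner_stdVec i (J _), hJ.inner_eq, entry]
  simp only [lp.coeFn_add, lp.coeFn_smul, Pi.add_apply, Pi.smul_apply, stdVec_apply, smul_eq_mul]
  rcases lt_trichotomy i (k + 1) with h | h | h
  · by_cases hk : i = k
    · subst hk; simp
    · simp [hk, h.ne, show k ≠ i by omega, show i ≠ k + 2 by omega]
  · subst h; simp
  · by_cases hk : i = k + 2
    · subst hk; simp
    · simp [hk, h.ne', show k ≠ i by omega, show i ≠ k by omega]

theorem IsJacobiOperator.apply_apply_zero (hJ : IsJacobiOperator a J) (v : EllTwo) :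
    J v 0 = a.α 0 * v 0 + a.β 0 * v 1 := by
  rw [← inner_stdVec 0 (J v), ← ContinuousLinearMap.adjoint_inner_left,
    hJ.isSelfAdjoint.adjoint_eq, hJ.apply_stdVec_zero]
  simp only [inner_add_left, inner_smul_left, inner_stdVec, Complex.conj_ofReal]

theorem IsJacobiOperator.apply_apply_succ (hJ : IsJacobiOperator a J) (v : EllTwo) (k : ℕ) :
    J v (k + 1) = a.β k * v k + a.α (k + 1) * v (k + 1) + a.β (k + 1) * v (k + 2) := by
  rw [← inner_stdVec (k + 1) (J v), ← ContinuousLinearMap.adjoint_inner_left,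
    hJ.isSelfAdjoint.adjoint_eq, hJ.apply_stdVec_succ]
  simp only [inner_add_left, inner_smul_left, inner_stdVec, Complex.conj_ofReal]

/-- The combination `G(w) P_k(w) + P^μ_k(w)` is the `k`-th entry of `(J - w)⁻¹ e_0`. -/
theorem IsJacobiOperator.tendsto_resolvent_solution (hJ : IsJacobiOperator a J) {w : ℂ}
    (hw : w ∉ spectrum ℂ J) :
    Tendsto (fun k => principalResolvent J w * aeval w (a.orthoPoly k) + aeval w (a.assocPoly k))
      atTop (𝓝 0) := by
  set T := J - algebraMap ℂ (EllTwo →L[ℂ] EllTwo) w with hT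
  have hu : IsUnit T := by
    rw [spectrum.notMem_iff] at hw
    rw [hT, ← neg_sub]
    exact hw.neg
  set v : EllTwo := Ring.inverse T (stdVec 0) with hv
  have hTv : ∀ k, J v k = w * v k + stdVec 0 k := by
    intro k
    have : T v = stdVec 0 := by
      rw [hv, ← mul_apply_eq_comp, Ring.mul_inverse_cancel _ hu,
        one_apply_eq_self]
    have h2 : J v = w • v + stdVec 0 := by
      rw [← this, hT, sub_apply, Algebra.algebraMap_eq_smul_one]
      simp
    rw [h2]
    rfl
  have hG : principalResolvent J w = v 0 := inner_stdVec 0 v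
  have hrec : a.IsRecurrent w fun k => v k := by
    intro k
    have e := hTv (k + 1)
    rw [hJ.apply_apply_succ, stdVec_apply, if_neg (by omega), add_zero] at e
    exact e.symm
  have hrec2 : a.IsRecurrent w fun k =>
      principalResolvent J w * aeval w (a.orthoPoly k) + aeval w (a.assocPoly k) := by
    intro k
    have e1 := a.isRecurrent_orthoPoly.aeval w k
    have e2 := a.isRecurrent_assocPoly.aeval w k
    dsimp only at e1 e2 ⊢
    linear_combination principalResolvent J w * e1 + e2
  rw [hrec2.eq_of_eq hrec (by simp [orthoPoly, assocPoly, hG]) ?_]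
  · exact v.tendsto_zero
  -- Row `0` carries the source term `e_0`; it accounts for the initial value `P^μ_1 = β_0⁻¹`.
  · have e := hTv 0
    rw [hJ.apply_apply_zero, stdVec_apply, if_pos rfl] at e
    have hb : (a.β 0 : ℂ) ≠ 0 := by exact_mod_cast (a.β_pos 0).ne'
    refine mul_left_cancel₀ hb ?_
    simp only [hG, orthoPoly, assocPoly, map_mul, map_sub, aeval_C, aeval_X,
      Complex.coe_algebraMap, Complex.ofReal_inv]
    linear_combination (v 0 * (w - a.α 0) + 1) * mul_inv_cancel₀ hb - e

end Resolvent

/-! ### The Wronskian and the resolvent formula -/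

theorem wronskian_orthoPoly_assocPoly (a : JacobiCoeffs) (w : ℂ) (k : ℕ) :
    (a.β k : ℂ) * (aeval w (a.orthoPoly k) * aeval w (a.assocPoly (k + 1)) -
      aeval w (a.orthoPoly (k + 1)) * aeval w (a.assocPoly k)) = 1 := by
  have e := (a.isRecurrent_orthoPoly.aeval w).wronskian (a.isRecurrent_assocPoly.aeval w) k
  rw [e]
  have hb : (a.β 0 : ℂ) ≠ 0 := by exact_mod_cast (a.β_pos 0).ne'
  simp [orthoPoly, assocPoly, hb]

theorem theorem4p11 (a : JacobiCoeffs) (n : ℕ)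
    (hα : ∀ k, n ≤ k → a.α k = 0)
    (hβ : ∀ k, n ≤ k + 1 → a.β k = 1 / 2)
    (J : EllTwo →L[ℂ] EllTwo) (hJ : IsJacobiOperator a J) :
    (∃! c : ℝ[X], IsToeplitzSymbol (connC a) c) ∧
    (∃! cμ : ℝ[X], IsToeplitzSymbol (connCmu a) cμ) ∧
    ∀ c cμ : ℝ[X], IsToeplitzSymbol (connC a) c → IsToeplitzSymbol (connCmu a) cμ →
      -- the value at `z = 0`, which the Joukowski map sends to `∞`, where `G` vanishes
      (c.eval 0 ≠ 0 ∧ cμ.eval 0 = 0) ∧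
      ∀ z : ℂ, z ≠ 0 → ‖z‖ < 1 → joukowski z ∉ spectrum ℂ J →
        aeval z c ≠ 0 ∧
        principalResolvent J (joukowski z) = -(aeval z cμ / aeval z c) := by
  have htri : ∀ i k, k < i → connectionMatrix a.orthoPoly free i k = 0 := connC_eq_zero_of_lt a
  have htriμ : ∀ i k, k < i → connectionMatrix a.assocPoly free i k = 0 :=
    fun i k h => connCmu_eq_zero_of_le a i k h.le
  obtain ⟨c₀, hc₀⟩ :=
    exists_isToeplitzSymbol_connectionMatrix hα hβ a.isRecurrent_orthoPoly htri
  obtain ⟨d₀, hd₀⟩ :=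
    exists_isToeplitzSymbol_connectionMatrix hα hβ a.isRecurrent_assocPoly htriμ
  refine ⟨⟨c₀, hc₀, fun t ht => ht.unique hc₀⟩, ⟨d₀, hd₀, fun t ht => ht.unique hd₀⟩, ?_⟩
  intro c cμ hc hcμ
  refine ⟨⟨?_, ?_⟩, fun z hz hz1 hspec => ?_⟩
  · obtain ⟨K, hK⟩ := hc.exists_coeff_eq
    rw [← coeff_zero_eq_eval_zero, hK K 0 le_rfl]
    exact connC_diag_ne_zero a K
  · obtain ⟨K, hK⟩ := hcμ.exists_coeff_eq
    rw [← coeff_zero_eq_eval_zero, hK K 0 le_rfl]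
    exact connCmu_eq_zero_of_le a K K le_rfl
  · have eP := eventually_aeval_eq htri hc hz
    have eQ := eventually_aeval_eq htriμ hcμ hz
    have key : principalResolvent J (joukowski z) * aeval z c + aeval z cμ = 0 := by
      have hlim := (hJ.tendsto_resolvent_solution hspec).const_mul (z⁻¹ - z)
      rw [mul_zero] at hlim
      refine eq_zero_of_tendsto_zero hz hz1 hlim
        (B := principalResolvent J (joukowski z) * aeval z⁻¹ c + aeval z⁻¹ cμ) ?_
      filter_upwards [eP, eQ] with k h1 h2
      linear_combination principalResolvent J (joukowski z) * h1 + h2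
    have hne : aeval z c ≠ 0 := by
      intro h0
      have h0μ : aeval z cμ = 0 := by simpa [h0] using key
      rw [h0] at eP
      rw [h0μ] at eQ
      have tP := tendsto_zero_of_eventually_eq hz hz1 eP
      have tQ := tendsto_zero_of_eventually_eq hz hz1 eQ
      -- For large `k` the factor `β_k` is `1/2`, so this limit of Wronskians would be `0`, yet each
      -- equals `1`.
      have hlim := ((tP.mul (tQ.comp (tendsto_add_atTop_nat 1))).sub
        ((tP.comp (tendsto_add_atTop_nat 1)).mul tQ)).const_mul (1 / 2 : ℂ)
      simp only [mul_zero, sub_zero] at hlim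
      refine one_ne_zero (tendsto_nhds_unique (tendsto_const_nhds.congr' ?_) hlim)
      filter_upwards [eventually_ge_atTop n] with k hk
      have e := wronskian_orthoPoly_assocPoly a (joukowski z) k
      rw [hβ k (by omega)] at e
      push_cast at e
      exact e.symm
    refine ⟨hne, ?_⟩
    rw [← neg_div, eq_div_iff hne]
    linear_combination key
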